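/- Let $G$ be a finite simple graph with vertex set $V$. A set $D\subseteq V$ is dominating if every vertex of $V\setminus D$ has a neighbour in $D$. For positive integers $k,s$, a $(k,s)$-configuration of $G$ is a multiset of $k$ dominating sets of $G$ such that every vertex of $G$ belongs to at most $s$ of them, counted with multiplicity. The fractional domatic number $FD(G)$ is the supremum of $k/s$ over all positive integers $k,s$ for which $G$ admits a $(k,s)$-configuration. The graph $G$ is 2-connected if it is connected, has at least three vertices, and remains connected after the deletion of any single vertex. **Theorem.** Let $G$ be a finite 2-connected graph that is not isomorphic to the 4-cycle $C_4$. Then $FD(G)>2$. Moreover, if every (not necessarily induced) cycle of $G$ has length 4, then $G$ is isomorphic to the complete bipartite graph $K_{2,p}$ for some $p\ge 3$, and $G$ admits a $(3p-2,p)$-configuration. -/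

import Mathlib

namespace SimpleGraph

variable {V : Type*}

/-- `v` is a cut vertex of `G`: `G` is connected and deleting `v` disconnects it. -/
def IsCutVertex (G : SimpleGraph V) (v : V) : Prop :=
  G.Connected ∧ ¬ (G.induce {v}ᶜ).Preconnected

/-- A finite graph is 2-connected if it is connected, has at least three vertices
and has no cut vertex. -/
def IsTwoConnected (G : SimpleGraph V) : Prop :=
  G.Connected ∧ 3 ≤ Nat.card V ∧ ∀ v, ¬ G.IsCutVertex v

/-- `D` is a dominating set: every vertex outside `D` has a neighbour in `D`. -/
def IsDominatingSet (G : SimpleGraph V) (D : Set V) : Prop :=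
  ∀ v, v ∉ D → ∃ w ∈ D, G.Adj v w

/-- The indexed family `D 0, …, D (k - 1)` (a multiset of `k` sets, repetitions being allowed)
is a `(k, s)`-configuration of `G`: `k ≥ 1`, every member is a dominating set, and every vertex
belongs to at most `s` members, counted with multiplicity. -/
def IsConfiguration (G : SimpleGraph V) (k s : ℕ) (D : Fin k → Set V) : Prop :=
  1 ≤ k ∧ (∀ i, G.IsDominatingSet (D i)) ∧ ∀ v, {i | v ∈ D i}.ncard ≤ s

/-- `G` admits a `(k, s)`-configuration. -/
def HasConfiguration (G : SimpleGraph V) (k s : ℕ) : Prop :=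
  ∃ D : Fin k → Set V, G.IsConfiguration k s D

/-- The ratios `k / s` over all positive integers `k`, `s` such that `G` admits
a `(k, s)`-configuration. -/
def configurationRatios (G : SimpleGraph V) : Set ℝ :=
  {q | ∃ k s : ℕ, 1 ≤ s ∧ G.HasConfiguration k s ∧ q = (k : ℝ) / (s : ℝ)}

/-- The fractional domatic number of `G`. For a finite nonempty graph the set of ratios is
nonempty and bounded above (see the two lemmas below), so this is a genuine supremum. -/
noncomputable def fractionalDomaticNumber (G : SimpleGraph V) : ℝ :=
  sSup G.configurationRatios

theorem configurationRatios_nonempty (G : SimpleGraph V) : G.configurationRatios.Nonempty := by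
  refine ⟨_, 1, 1, le_rfl, ⟨fun _ => Set.univ, le_rfl, fun _ v hv => (hv trivial).elim, ?_⟩, rfl⟩
  intro v
  exact (Set.ncard_le_card _).trans (by simp)

theorem configurationRatios_bddAbove [Finite V] [Nonempty V] (G : SimpleGraph V) :
    BddAbove G.configurationRatios := by
  classical
  have := Fintype.ofFinite V
  refine ⟨Fintype.card V, ?_⟩
  rintro q ⟨k, s, hs, ⟨D, -, hD, hc⟩, rfl⟩
  have hne : ∀ i, ∃ v, v ∈ D i := by
    intro i
    by_contra! h
    obtain ⟨w, hw, -⟩ := hD i (Classical.arbitrary V) (h _)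
    exact h w hw
  choose f hf using hne
  have h1 : k ≤ s * Fintype.card V := by
    have := Finset.card_le_mul_card_image_of_maps_to (s := (Finset.univ : Finset (Fin k)))
      (t := (Finset.univ : Finset V)) (f := f) (fun _ _ => Finset.mem_univ _) s (by
        intro v _
        refine le_trans ?_ (hc v)
        rw [← Set.ncard_coe_finset]
        refine Set.ncard_le_ncard ?_ (Set.toFinite _)
        intro i hi
        have : f i = v := by simpa using hi
        exact this ▸ hf i)
    simpa using this
  have hs' : (0 : ℝ) < s := by exact_mod_cast hs
  rw [div_le_iff₀ hs', mul_comm]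
  exact_mod_cast h1

end SimpleGraph

/-!
Call a vertex `v` *spared* if there are two disjoint dominating sets neither of which contains `v`,
and let `W` be the set of spared vertices. If `W` is dominating and has `m` elements, then the
`2m` dominating sets witnessing that the vertices of `W` are spared, together with `W` itself,
form a `(2m + 1, m)`-configuration: each pair covers a vertex at most once, and for a vertex of `W`
the set `W` makes up for the pair that spares it. Hence the fractional domatic number exceeds `2`
(`two_lt_fractionalDomaticNumber`).

It remains to see that `W` is dominating. Let `x` and `y` be two neighbours of `v`. Two disjoint
sets `A` and `B` in `G - v`, such that each element of either has a neighbour in the other, can be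
enlarged until they cover the connected graph `G - v`; if moreover `x ∈ A` and `y ∈ B`, they then
show that `v` is spared (`isSpared_of_partial`). If `x` and `y` have distinct neighbours `c` and `d`
in `G - v`, then `{x, d}` and `{y, c}` are such sets (possibly `c = y` or `d = x`).
If `v` is not spared, it follows that all its neighbours have the same neighbourhood `{v, c}`
(`exists_neighborSet_eq_of_not_isSpared`). If a neighbour of `v` is not spared either, then
`v`, `c` and their two neighbours form a 4-cycle, which is all of `G`. Otherwise no two
vertices outside `W` are adjacent, and `W` is dominating because there are no isolated vertices.

If all cycles have length 4, then every path avoiding `v` between two neighbours of `v` has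
length 2 (`length_eq_two_of_isPath`). If `v` has at least three neighbours, this forces a second
vertex `c` with the same neighbours as `v`, and these have no neighbours other than `v` and `c`;
if there is no such vertex `v`, the same picture with two neighbours gives the 4-cycle.
-/

namespace SimpleGraph

variable {V : Type*} {G : SimpleGraph V}

/-! ### Consequences of 2-connectedness -/

theorem IsTwoConnected.preconnected_induce_compl (hG : G.IsTwoConnected) (v : V) :
    (G.induce {v}ᶜ).Preconnected := by
  by_contra h
  exact hG.2.2 v ⟨hG.1, h⟩

/-- In a 2-connected graph, a nonempty set of vertices of `G - v` that is not everything
sends an edge to the rest of `G - v`. -/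
theorem IsTwoConnected.exists_adj_boundary (hG : G.IsTwoConnected) {v a b : V} {S : Set V}
    (ha : a ∈ S) (hb : b ∉ S) (hav : a ≠ v) (hbv : b ≠ v) :
    ∃ s ∈ S, ∃ w ∉ S, w ≠ v ∧ G.Adj s w := by
  obtain ⟨p⟩ := hG.preconnected_induce_compl v ⟨a, hav⟩ ⟨b, hbv⟩
  obtain ⟨d, -, h1, h2⟩ := p.exists_boundary_dart (Subtype.val ⁻¹' S) ha hb
  exact ⟨_, h1, _, h2, d.snd.2, d.adj⟩

theorem IsTwoConnected.exists_adj_ne (hG : G.IsTwoConnected) {w v : V} (h : w ≠ v) :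
    ∃ u, u ≠ v ∧ G.Adj w u := by
  have : ∃ b, b ≠ w ∧ b ≠ v := by
    by_contra! hb
    have h3 : (Set.univ : Set V).ncard ≤ ({w, v} : Set V).ncard :=
      Set.ncard_le_ncard fun b _ => by
        by_cases hbw : b = w
        · exact Or.inl hbw
        · exact Or.inr (hb b hbw)
    have := hG.2.1
    rw [Set.ncard_univ, Set.ncard_pair h] at h3
    omega
  obtain ⟨b, hbw, hbv⟩ := this
  obtain ⟨s, rfl, u, -, hu, hsu⟩ := hG.exists_adj_boundary (Set.mem_singleton w) hbw h hbv
  exact ⟨u, hu, hsu⟩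

theorem IsTwoConnected.exists_adj_adj_ne (hG : G.IsTwoConnected) (v : V) :
    ∃ x y, x ≠ y ∧ G.Adj v x ∧ G.Adj v y := by
  have : Nontrivial V := by
    have h := hG.2.1
    have := Nat.finite_of_card_ne_zero (α := V) (by omega)
    exact Finite.one_lt_card_iff_nontrivial.1 (by omega)
  obtain ⟨u, hu⟩ := exists_ne v
  obtain ⟨x, -, hx⟩ := hG.exists_adj_ne hu.symm
  obtain ⟨y, hy, hvy⟩ := hG.exists_adj_ne hx.ne
  exact ⟨x, y, hy.symm, hx, hvy⟩

/-! ### Complete bipartite graphs with a side of size two -/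

/-- A connected graph in which `v` and `c` have the same neighbours, which in turn have no
neighbours besides `v` and `c`, is complete bipartite. -/
theorem nonempty_iso_completeBipartiteGraph [Finite V] (hG : G.Connected) {v c : V} (hvc : v ≠ c)
    (hN : G.neighborSet c = G.neighborSet v) (hS : ∀ x, G.Adj v x → G.neighborSet x = {v, c}) :
    Nonempty (G ≃g completeBipartiteGraph (Fin 2) (Fin (G.neighborSet v).ncard)) := by
  classical
  have hN' : ∀ x, G.Adj c x ↔ G.Adj v x := fun x => Set.ext_iff.1 hN x
  have hS' : ∀ x, G.Adj v x → ∀ y, G.Adj x y ↔ y = v ∨ y = c :=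
    fun x hx y => Set.ext_iff.1 (hS x hx) y
  let e : Fin (G.neighborSet v).ncard ≃ G.neighborSet v := (Finite.equivFin (G.neighborSet v)).symm
  have hadj : ∀ i, G.Adj v (e i) := fun i => (e i).2
  have hvc' : ¬ G.Adj v c := fun h => G.irrefl ((hN' c).2 h)
  let F : Fin 2 ⊕ Fin (G.neighborSet v).ncard → V := Sum.elim ![v, c] fun i => e i
  have hF0 : ∀ a : Fin 2, ![v, c] a = v ∨ ![v, c] a = c := by
    intro a; fin_cases a <;> simp
  have hF1 : ∀ (a : Fin 2) x, G.Adj (![v, c] a) x ↔ G.Adj v x := by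
    intro a x; fin_cases a <;> simp [hN']
  have hinj : Function.Injective F := by
    refine Function.Injective.sumElim ?_ (Subtype.val_injective.comp e.injective) ?_
    · intro a b hab
      fin_cases a <;> fin_cases b <;> simp_all [eq_comm]
    · intro a i h
      have := hadj i
      rw [← h] at this
      rcases hF0 a with h | h <;> rw [h] at this
      · exact G.irrefl this
      · exact hvc' this
  have hsurj : Function.Surjective F := by
    intro w
    by_contra hw
    obtain ⟨p⟩ := hG.preconnected v w
    obtain ⟨d, -, ⟨i, hi⟩, h2⟩ := p.exists_boundary_dart (Set.range F) ⟨Sum.inl 0, rfl⟩ hw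
    have had := d.adj
    rw [← hi] at had
    rcases i with a | i
    · have : G.Adj v d.snd := (hF1 a _).1 had
      exact h2 ⟨Sum.inr (e.symm ⟨d.snd, this⟩), by simp [F]⟩
    · rcases (hS' _ (hadj i) _).1 had with h | h
      · exact h2 ⟨Sum.inl 0, h.symm⟩
      · exact h2 ⟨Sum.inl 1, h.symm⟩
  refine ⟨(RelIso.mk (Equiv.ofBijective F ⟨hinj, hsurj⟩) ?_ :
    completeBipartiteGraph (Fin 2) (Fin (G.neighborSet v).ncard) ≃g G).symm⟩
  change ∀ a b, G.Adj (F a) (F b) ↔ (completeBipartiteGraph _ _).Adj a b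
  rintro (a | i) (b | j)
  · have : ¬ G.Adj (![v, c] a) (![v, c] b) := by
      rw [hF1]
      rcases hF0 b with h | h <;> rw [h]
      · exact G.irrefl
      · exact hvc'
    simpa [F] using this
  · simpa [F, hF1] using hadj j
  · simpa [F, G.adj_comm _ (![v, c] b), hF1] using hadj i
  · have : ¬ G.Adj (e i : V) (e j) := by
      rw [hS' _ (hadj i)]
      rintro (h | h)
      · exact G.irrefl (h ▸ hadj j)
      · exact hvc' (h ▸ hadj j)
    simpa [F] using this

theorem nonempty_completeBipartiteGraph_iso_cycleGraph_four :
    Nonempty (completeBipartiteGraph (Fin 2) (Fin 2) ≃g cycleGraph 4) := by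
  let F : Fin 2 ⊕ Fin 2 → Fin 4 := Sum.elim ![0, 2] ![1, 3]
  have hF : Function.Bijective F := by decide
  refine ⟨RelIso.mk (Equiv.ofBijective F hF) ?_⟩
  change ∀ a b, (cycleGraph 4).Adj (F a) (F b) ↔ (completeBipartiteGraph (Fin 2) (Fin 2)).Adj a b
  simp only [completeBipartiteGraph_adj, cycleGraph_adj]
  decide

theorem nonempty_iso_cycleGraph_four [Finite V] (hG : G.Connected) {v c x y : V} (hvc : v ≠ c)
    (hxy : x ≠ y) (hv : G.neighborSet v = {x, y}) (hc : G.neighborSet c = {x, y})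
    (hx : G.neighborSet x = {v, c}) (hy : G.neighborSet y = {v, c}) :
    Nonempty (G ≃g cycleGraph 4) := by
  obtain ⟨e⟩ := nonempty_iso_completeBipartiteGraph hG hvc (hc.trans hv.symm) (by
    intro z hz
    rw [← mem_neighborSet, hv] at hz
    rcases hz with rfl | rfl
    exacts [hx, hy])
  rw [hv, Set.ncard_pair hxy] at e
  obtain ⟨f⟩ := nonempty_completeBipartiteGraph_iso_cycleGraph_four
  exact ⟨e.trans f⟩

/-! ### Building configurations -/

theorem hasConfiguration_of_finite {ι : Type*} [Finite ι] [Nonempty ι] {s : ℕ} (D : ι → Set V)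
    (hD : ∀ i, G.IsDominatingSet (D i)) (hs : ∀ v, {i | v ∈ D i}.ncard ≤ s) :
    G.HasConfiguration (Nat.card ι) s := by
  let e := Finite.equivFin ι
  refine ⟨fun i => D (e.symm i), Nat.card_pos, fun i => hD _, fun v => ?_⟩
  refine le_trans (le_of_eq ?_) (hs v)
  rw [← Set.ncard_image_of_injective _ e.symm.injective]
  congr 1
  ext i
  simp

theorem HasConfiguration.of_iso {W : Type*} {H : SimpleGraph W} {k s : ℕ} (e : G ≃g H)
    (h : H.HasConfiguration k s) : G.HasConfiguration k s := by
  obtain ⟨D, hk, hD, hs⟩ := h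
  refine ⟨fun i => e ⁻¹' D i, hk, fun i v hv => ?_, fun v => hs (e v)⟩
  obtain ⟨w, hw, hvw⟩ := hD i (e v) hv
  exact ⟨e.symm w, by simpa using hw, by rw [← e.map_adj_iff]; simpa using hvw⟩

/-- The configuration consists of the `2p` edges together with `p - 2` copies of the side of
size `p`. -/
theorem hasConfiguration_completeBipartiteGraph_two {p : ℕ} (hp : 2 ≤ p) :
    (completeBipartiteGraph (Fin 2) (Fin p)).HasConfiguration (3 * p - 2) p := by
  let D : (Fin 2 × Fin p) ⊕ Fin (p - 2) → Set (Fin 2 ⊕ Fin p) :=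
    Sum.elim (fun q => {Sum.inl q.1, Sum.inr q.2}) fun _ => Set.range Sum.inr
  have hcard : Nat.card ((Fin 2 × Fin p) ⊕ Fin (p - 2)) = 3 * p - 2 := by
    simp
    omega
  have : Nonempty (Fin p) := ⟨⟨0, by omega⟩⟩
  rw [← hcard]
  refine hasConfiguration_of_finite D ?_ ?_
  · rintro (⟨a, x⟩ | i) (b | y) h
    · exact ⟨Sum.inr x, by simp [D], by simp⟩
    · exact ⟨Sum.inl a, by simp [D], by simp⟩
    · exact ⟨Sum.inr ⟨0, by omega⟩, by simp [D], by simp⟩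
    · simp [D] at h
  · rintro (a | x)
    · calc _ ≤ (Set.range fun x : Fin p =>
            (Sum.inl (a, x) : (Fin 2 × Fin p) ⊕ Fin (p - 2))).ncard := by
            refine Set.ncard_le_ncard ?_ (Set.toFinite _)
            rintro (⟨b, y⟩ | i) h
            · simp only [D, Set.mem_ofPred_eq, Sum.elim_inl, Set.mem_insert_iff, Sum.inl.injEq,
                Set.mem_singleton_iff, reduceCtorEq, or_false] at h
              exact ⟨y, by rw [h]⟩
            · simp [D] at h
        _ ≤ p := by
            rw [← Set.image_univ]
            exact (Set.ncard_image_le (Set.toFinite _)).trans (by simp [Set.ncard_univ])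
    · calc _ ≤ (Set.range (Sum.elim (fun a : Fin 2 => Sum.inl (a, x)) Sum.inr :
            Fin 2 ⊕ Fin (p - 2) → (Fin 2 × Fin p) ⊕ Fin (p - 2))).ncard := by
            refine Set.ncard_le_ncard ?_ (Set.toFinite _)
            rintro (⟨b, y⟩ | i) h
            · simp only [D, Set.mem_ofPred_eq, Sum.elim_inl, Set.mem_insert_iff, Sum.inr.injEq,
                Set.mem_singleton_iff, reduceCtorEq, false_or] at h
              exact ⟨Sum.inl b, by rw [h]; rfl⟩
            · exact ⟨Sum.inr i, rfl⟩
        _ ≤ p := by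
            rw [← Set.image_univ]
            refine (Set.ncard_image_le (Set.toFinite _)).trans ?_
            simp [Set.ncard_univ]
            omega

/-! ### Spared vertices -/

/-- A vertex is spared if it lies outside the union of some two disjoint dominating sets. -/
def IsSpared (G : SimpleGraph V) (v : V) : Prop :=
  ∃ A B : Set V, Disjoint A B ∧ G.IsDominatingSet A ∧ G.IsDominatingSet B ∧ v ∉ A ∧ v ∉ B

theorem two_lt_fractionalDomaticNumber [Finite V] [Nonempty V]
    (hW : G.IsDominatingSet {v | G.IsSpared v}) : 2 < G.fractionalDomaticNumber := by
  classical
  set W := {v | G.IsSpared v} with hWdef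
  have hne : W.Nonempty := by
    by_contra h
    rw [Set.not_nonempty_iff_eq_empty] at h
    obtain ⟨w, hw, -⟩ := hW (Classical.arbitrary V) (by simp [h])
    simp [h] at hw
  choose A B hAB hA hB hvA hvB using fun w : W => w.2
  let D : Option (W × Bool) → Set V := fun o => o.elim W fun q => if q.2 then A q.1 else B q.1
  have hcard : Nat.card (Option (W × Bool)) = 2 * W.ncard + 1 := by
    rw [Finite.card_option, Nat.card_prod, Nat.card_coe_set_eq]
    simp [mul_comm]
  have hconf : G.HasConfiguration (2 * W.ncard + 1) W.ncard := by
    rw [← hcard]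
    refine hasConfiguration_of_finite D ?_ fun u => ?_
    · rintro (_ | ⟨w, _ | _⟩)
      exacts [hW, hB w, hA w]
    · -- Send each set of the `w`-th pair to `w` and `W` itself to `u`; on the sets containing `u`
      -- this is injective, as the two sets in a pair are disjoint and the `u`-th pair spares `u`.
      refine Set.ncard_le_ncard_of_injOn (fun o => o.elim u fun q => (q.1 : V)) ?_ ?_
        (Set.toFinite _)
      · rintro (_ | ⟨w, b⟩) h
        exacts [h, w.2]
      · have key : ∀ (w : W) (b : Bool), u ∈ D (some (w, b)) → u ≠ w := by
          rintro w (_ | _) h rfl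
          exacts [hvB _ h, hvA _ h]
        rintro (_ | ⟨w, b⟩) h (_ | ⟨w', b'⟩) h' heq
        · rfl
        · exact (key _ _ h' heq).elim
        · exact (key _ _ h heq.symm).elim
        · obtain rfl : w = w' := Subtype.ext heq
          cases b <;> cases b'
          · rfl
          · exact ((hAB w).le_bot ⟨h', h⟩).elim
          · exact ((hAB w).le_bot ⟨h, h'⟩).elim
          · rfl
  have hpos : 1 ≤ W.ncard := (Set.ncard_pos (Set.toFinite _)).2 hne
  have hpos' : (0 : ℝ) < W.ncard := by exact_mod_cast hpos
  refine lt_of_lt_of_le ?_ (le_csSup (configurationRatios_bddAbove G)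
    ⟨2 * W.ncard + 1, W.ncard, hpos, hconf, rfl⟩)
  rw [lt_div_iff₀ hpos']
  push_cast
  linarith

/-- Disjoint sets `A` and `B` in `G - v`, containing neighbours `x` and `y` of `v` respectively and
such that each element of either has a neighbour in the other, can be enlarged until they cover
`G - v`; both are then dominating. -/
theorem isSpared_of_partial [Finite V] (hG : G.IsTwoConnected) {v x y : V} (hx : G.Adj v x)
    (hy : G.Adj v y) {A B : Set V} (hxA : x ∈ A) (hyB : y ∈ B) (hAB : Disjoint A B)
    (hvA : v ∉ A) (hvB : v ∉ B) (hA : ∀ a ∈ A, ∃ b ∈ B, G.Adj a b)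
    (hB : ∀ b ∈ B, ∃ a ∈ A, G.Adj b a) : G.IsSpared v := by
  let P : Set V × Set V → Prop := fun q => Disjoint q.1 q.2 ∧ v ∉ q.1 ∧ v ∉ q.2 ∧
    (∀ a ∈ q.1, ∃ b ∈ q.2, G.Adj a b) ∧ ∀ b ∈ q.2, ∃ a ∈ q.1, G.Adj b a
  obtain ⟨⟨A', B'⟩, ⟨hA', hB'⟩, ⟨hdis, hvA', hvB', h1, h2⟩, hmax⟩ :=
    (Set.toFinite {q | P q}).exists_le_maximal (a := (A, B)) ⟨hAB, hvA, hvB, hA, hB⟩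
  simp only at hA' hB' hdis hvA' hvB' h1 h2
  have hcover : ∀ w, w ≠ v → w ∈ A' ∪ B' := by
    intro b hb
    by_contra hbS
    obtain ⟨s, hs, w, hw, hwv, hsw⟩ :=
      hG.exists_adj_boundary (S := A' ∪ B') (Or.inl (hA' hxA)) hbS hx.ne' hb
    rw [Set.mem_union, not_or] at hw
    rcases hs with hs | hs
    · have hP : P (A', insert w B') := by
        refine ⟨Set.disjoint_insert_right.2 ⟨hw.1, hdis⟩, hvA', ?_, ?_, ?_⟩
        · rintro (h | h)
          exacts [hwv h.symm, hvB' h]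
        · intro a ha
          obtain ⟨b, hb, hab⟩ := h1 a ha
          exact ⟨b, Or.inr hb, hab⟩
        · rintro b (rfl | hb)
          exacts [⟨s, hs, hsw.symm⟩, h2 b hb]
      exact hw.2 ((hmax hP ⟨le_rfl, Set.subset_insert _ _⟩).2 (Set.mem_insert _ _))
    · have hP : P (insert w A', B') := by
        refine ⟨Set.disjoint_insert_left.2 ⟨hw.2, hdis⟩, ?_, hvB', ?_, ?_⟩
        · rintro (h | h)
          exacts [hwv h.symm, hvA' h]
        · rintro a (rfl | ha)
          exacts [⟨s, hs, hsw.symm⟩, h1 a ha]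
        · intro b hb
          obtain ⟨a, ha, hab⟩ := h2 b hb
          exact ⟨a, Or.inr ha, hab⟩
      exact hw.1 ((hmax hP ⟨Set.subset_insert _ _, le_rfl⟩).1 (Set.mem_insert _ _))
  refine ⟨A', B', hdis, fun w hw => ?_, fun w hw => ?_, hvA', hvB'⟩
  · by_cases h : w = v
    · exact ⟨x, hA' hxA, h ▸ hx⟩
    · exact h2 w ((hcover w h).resolve_left hw)
  · by_cases h : w = v
    · exact ⟨y, hB' hyB, h ▸ hy⟩
    · exact h1 w ((hcover w h).resolve_right hw)

/-- If `x` and `y` are neighbours of a vertex `v` that is not spared, then `x` and `y` have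
a single neighbour in `G - v`, the same for both. -/
theorem eq_of_not_isSpared [Finite V] (hG : G.IsTwoConnected) {v x y c d : V}
    (hv : ¬ G.IsSpared v) (hxy : x ≠ y) (hx : G.Adj v x) (hy : G.Adj v y) (hc : G.Adj x c)
    (hcv : c ≠ v) (hd : G.Adj y d) (hdv : d ≠ v) : c = d := by
  by_contra hcd
  refine hv (isSpared_of_partial hG hx hy (A := {x, d}) (B := {y, c}) (by simp) (by simp)
    ?_ ?_ ?_ ?_ ?_)
  · simp [hxy.symm, hd.ne, hc.ne', hcd]
  · simp [hx.ne, hdv.symm]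
  · simp [hy.ne, hcv.symm]
  · simp [hc, hd.symm]
  · simp [hc.symm, hd]

theorem exists_neighborSet_eq_of_not_isSpared [Finite V] (hG : G.IsTwoConnected) {v : V}
    (hv : ¬ G.IsSpared v) : ∃ c, c ≠ v ∧ ∀ x, G.Adj v x → G.neighborSet x = {v, c} := by
  obtain ⟨x, y, hxy, hx, hy⟩ := hG.exists_adj_adj_ne v
  obtain ⟨c, hcv, hxc⟩ := hG.exists_adj_ne hx.ne'
  obtain ⟨d, hdv, hyd⟩ := hG.exists_adj_ne hy.ne'
  obtain rfl := eq_of_not_isSpared hG hv hxy hx hy hxc hcv hyd hdv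
  -- Each neighbour `z` of `v` differs from one of `x` and `y`, to which it can be compared.
  have key : ∀ z, G.Adj v z → ∀ w, w ≠ v → G.Adj z w → w = c := by
    intro z hz w hw hzw
    by_cases hzx : z = x
    · exact eq_of_not_isSpared hG hv (hzx ▸ hxy) hz hy hzw hw hyd hcv
    · exact eq_of_not_isSpared hG hv hzx hz hx hzw hw hxc hcv
  refine ⟨c, hcv, fun z hz => Set.ext fun w => ⟨fun hw => ?_, ?_⟩⟩
  · by_cases hwv : w = v
    · exact Or.inl hwv
    · exact Or.inr (key z hz w hwv hw)
  · rintro (rfl | rfl)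
    · exact hz.symm
    · obtain ⟨u, hu, hzu⟩ := hG.exists_adj_ne hz.ne'
      exact key z hz u hu hzu ▸ hzu

theorem nonempty_iso_cycleGraph_four_of_not_isSpared [Finite V] (hG : G.IsTwoConnected) {v x : V}
    (hv : ¬ G.IsSpared v) (hx : ¬ G.IsSpared x) (hvx : G.Adj v x) :
    Nonempty (G ≃g cycleGraph 4) := by
  obtain ⟨c, hcv, hc⟩ := exists_neighborSet_eq_of_not_isSpared hG hv
  obtain ⟨y, hyx, hy⟩ := exists_neighborSet_eq_of_not_isSpared hG hx
  have hxc : G.Adj x c := by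
    rw [← mem_neighborSet, hc x hvx]
    simp
  have hvy : G.Adj v y := by
    rw [← mem_neighborSet, hy v hvx.symm]
    simp
  exact nonempty_iso_cycleGraph_four hG.1 hcv.symm hyx.symm (hy v hvx.symm) (hy c hxc)
    (hc x hvx) (hc y hvy)

/-! ### Graphs all of whose cycles have length four -/

/-- A path between two neighbours of `v` that avoids `v` closes up to a cycle through `v`. -/
theorem length_eq_two_of_isPath (h4 : ∀ (u : V) (c : G.Walk u u), c.IsCycle → c.length = 4)
    {v x y : V} (hxy : x ≠ y) (hx : G.Adj v x) (hy : G.Adj v y) (p : G.Walk x y)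
    (hp : p.IsPath) (hv : v ∉ p.support) : p.length = 2 := by
  have := h4 v (Walk.cons hx (p.concat hy.symm)) (by
    rw [Walk.cons_isCycle_iff]
    refine ⟨hp.concat hv hy.symm, ?_⟩
    rw [Walk.edges_concat, List.concat_eq_append, List.mem_append, not_or]
    refine ⟨fun h => hv (p.fst_mem_support_of_mem_edges h), ?_⟩
    simp only [List.mem_singleton, Sym2.eq_iff, not_or, not_and]
    exact ⟨fun h => (hy.ne h).elim, fun _ h => hxy h⟩)
  simp at this
  omega

theorem not_adj_of_adj_adj (h4 : ∀ (u : V) (c : G.Walk u u), c.IsCycle → c.length = 4)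
    {v x y : V} (hx : G.Adj v x) (hy : G.Adj v y) : ¬ G.Adj x y := by
  intro h
  have := length_eq_two_of_isPath h4 h.ne hx hy h.toWalk (by simp [h.ne])
    (by simp [hx.ne, hy.ne])
  simp at this

theorem exists_common_neighbor (hG : G.IsTwoConnected)
    (h4 : ∀ (u : V) (c : G.Walk u u), c.IsCycle → c.length = 4)
    {v x y : V} (hxy : x ≠ y) (hx : G.Adj v x) (hy : G.Adj v y) :
    ∃ c, c ≠ v ∧ G.Adj c x ∧ G.Adj c y := by
  classical
  obtain ⟨q, hq⟩ := (hG.preconnected_induce_compl v ⟨x, hx.ne'⟩ ⟨y, hy.ne'⟩).exists_isPath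
  let p : G.Walk x y := q.map (Embedding.induce {v}ᶜ).toHom
  have hp : p.IsPath := hq.map Subtype.val_injective
  have hv : v ∉ p.support := by
    intro h
    change v ∈ (q.map (Embedding.induce {v}ᶜ).toHom).support at h
    rw [Walk.support_map, List.mem_map] at h
    obtain ⟨w, -, hw⟩ := h
    exact w.2 hw
  have hlen := length_eq_two_of_isPath h4 hxy hx hy p hp hv
  revert hlen hv
  generalize p = p'
  intro hv hlen
  match p', hlen with
  | .cons h1 (.cons h2 .nil), _ =>
    refine ⟨_, ?_, h1.symm, h2⟩
    rintro rfl
    simp at hv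

/-- Otherwise `y`, `c`, `x`, `c'`, `z` would be a path of length 4 avoiding `v`. -/
theorem common_neighbor_eq (h4 : ∀ (u : V) (c : G.Walk u u), c.IsCycle → c.length = 4)
    {v x y z c c' : V} (hxy : x ≠ y) (hxz : x ≠ z) (hyz : y ≠ z) (hx : G.Adj v x)
    (hy : G.Adj v y) (hz : G.Adj v z) (hcv : c ≠ v) (hcx : G.Adj c x) (hcy : G.Adj c y)
    (hcv' : c' ≠ v) (hcx' : G.Adj c' x) (hcz' : G.Adj c' z) : c = c' := by
  by_contra hcc
  have hcz : c ≠ z := fun h => not_adj_of_adj_adj h4 hz hx (h ▸ hcx)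
  have hcy' : c' ≠ y := fun h => not_adj_of_adj_adj h4 hy hx (h ▸ hcx')
  have := length_eq_two_of_isPath h4 hyz hy hz
    (.cons hcy.symm (.cons hcx (.cons hcx'.symm (.cons hcz' .nil))))
    (by simp [hcy.ne', hxy.symm, hcy'.symm, hyz, hcx.ne, hcc, hcz, hcx'.ne', hxz, hcz'.ne])
    (by simp [hy.ne, hcv.symm, hx.ne, hcv'.symm, hz.ne])
  simp at this

theorem adj_of_common_neighbor (hG : G.IsTwoConnected)
    (h4 : ∀ (u : V) (c : G.Walk u u), c.IsCycle → c.length = 4)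
    {v x y c : V} (hxy : x ≠ y) (hx : G.Adj v x) (hy : G.Adj v y)
    (hcv : c ≠ v) (hcx : G.Adj c x) (hcy : G.Adj c y) {z : V} (hz : G.Adj v z) : G.Adj c z := by
  by_cases hzx : z = x
  · exact hzx ▸ hcx
  by_cases hzy : z = y
  · exact hzy ▸ hcy
  obtain ⟨c', hcv', hcx', hcz'⟩ := exists_common_neighbor hG h4 (Ne.symm hzx) hx hz
  exact common_neighbor_eq h4 hxy (Ne.symm hzx) (Ne.symm hzy) hx hy hz hcv hcx hcy hcv' hcx' hcz' ▸
    hcz'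

theorem exists_iso_completeBipartiteGraph [Finite V] (hG : G.IsTwoConnected)
    (hC4 : IsEmpty (G ≃g cycleGraph 4))
    (h4 : ∀ (u : V) (c : G.Walk u u), c.IsCycle → c.length = 4) :
    ∃ p : ℕ, 3 ≤ p ∧ Nonempty (G ≃g completeBipartiteGraph (Fin 2) (Fin p)) := by
  by_cases h3 : ∃ v x y z, x ≠ y ∧ x ≠ z ∧ y ≠ z ∧ G.Adj v x ∧ G.Adj v y ∧ G.Adj v z
  · obtain ⟨v, x, y, z, hxy, hxz, hyz, hx, hy, hz⟩ := h3
    obtain ⟨c, hcv, hcx, hcy⟩ := exists_common_neighbor hG h4 hxy hx hy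
    have hvc : ∀ w, G.Adj v w → G.Adj c w := fun w hw =>
      adj_of_common_neighbor hG h4 hxy hx hy hcv hcx hcy hw
    have hcv' : ∀ w, G.Adj c w → G.Adj v w := fun w hw =>
      adj_of_common_neighbor hG h4 hxy hcx hcy hcv.symm hx hy hw
    refine ⟨(G.neighborSet v).ncard, ?_, nonempty_iso_completeBipartiteGraph hG.1 hcv.symm
      (Set.ext fun w => ⟨hcv' w, hvc w⟩) fun a ha => Set.ext fun w => ⟨fun haw => ?_, ?_⟩⟩
    · exact (Set.two_lt_ncard_iff (Set.toFinite _)).2 ⟨x, y, z, hx, hy, hz, hxy, hxz, hyz⟩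
    · by_contra hw
      obtain ⟨hwv, hwc⟩ := not_or.1 hw
      -- The vertices `v` and `w` have a common neighbour `b` other than `a`. Then `w` and `c` are
      -- common neighbours of `a` and `b`, hence equal by comparison with a third neighbour of `v`.
      obtain ⟨b, hba, hbv, hbw⟩ := exists_common_neighbor hG h4 (Ne.symm hwv) ha.symm haw
      obtain ⟨t, ht, hta, htb⟩ : ∃ t, G.Adj v t ∧ t ≠ a ∧ t ≠ b := by
        by_contra! h
        have h' : ∀ t, G.Adj v t → t = a ∨ t = b := fun t ht => or_iff_not_imp_left.2 (h t ht)
        rcases h' x hx with h1 | h1 <;> rcases h' y hy with h2 | h2 <;>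
          rcases h' z hz with h3 | h3 <;> simp_all
      exact hwc (common_neighbor_eq h4 hba.symm hta.symm htb.symm ha hbv.symm ht hwv
        (G.adj_symm haw) hbw.symm hcv (hvc a ha) (hvc t ht))
    · rintro (rfl | rfl)
      exacts [ha.symm, (hvc a ha).symm]
  · -- With all degrees equal to two, the graph is a 4-cycle.
    have h2 : ∀ v x y, x ≠ y → G.Adj v x → G.Adj v y → G.neighborSet v = {x, y} := by
      intro v x y hxy hx hy
      refine Set.ext fun z => ⟨fun hz => ?_, ?_⟩
      · by_contra h
        obtain ⟨hzx, hzy⟩ := not_or.1 h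
        exact h3 ⟨v, x, y, z, hxy, Ne.symm hzx, Ne.symm hzy, hx, hy, hz⟩
      · rintro (rfl | rfl)
        exacts [hx, hy]
    obtain ⟨v⟩ := hG.1.nonempty
    obtain ⟨x, y, hxy, hx, hy⟩ := hG.exists_adj_adj_ne v
    obtain ⟨c, hcv, hcx, hcy⟩ := exists_common_neighbor hG h4 hxy hx hy
    exact (hC4.false (nonempty_iso_cycleGraph_four hG.1 hcv.symm hxy (h2 v x y hxy hx hy)
      (h2 c x y hxy hcx hcy) (h2 x v c hcv.symm hx.symm hcx.symm)
      (h2 y v c hcv.symm hy.symm hcy.symm)).some).elim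

end SimpleGraph

theorem mainTheorem3 {V : Type*} [Finite V] (G : SimpleGraph V)
    (hG : G.IsTwoConnected) (hC4 : IsEmpty (G ≃g SimpleGraph.cycleGraph 4)) :
    2 < G.fractionalDomaticNumber ∧
      ((∀ (u : V) (c : G.Walk u u), c.IsCycle → c.length = 4) →
        ∃ p : ℕ, 3 ≤ p ∧
          Nonempty (G ≃g completeBipartiteGraph (Fin 2) (Fin p)) ∧
          G.HasConfiguration (3 * p - 2) p) := by
  have := hG.1.nonempty
  refine ⟨SimpleGraph.two_lt_fractionalDomaticNumber fun v hv => ?_, fun h4 => ?_⟩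
  · obtain ⟨x, -, -, hx, -⟩ := hG.exists_adj_adj_ne v
    refine ⟨x, ?_, hx⟩
    by_contra hxs
    exact hC4.false (SimpleGraph.nonempty_iso_cycleGraph_four_of_not_isSpared hG hv hxs hx).some
  · obtain ⟨p, hp, ⟨e⟩⟩ := SimpleGraph.exists_iso_completeBipartiteGraph hG hC4 h4
    exact ⟨p, hp, ⟨e⟩, .of_iso e
      (SimpleGraph.hasConfiguration_completeBipartiteGraph_two (by omega))⟩
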